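/- For a group $G$, let $\omega(G)$ denote the number of orbits of the natural action of $\mathrm{Aut}(G)$ on $G$. For $m \ge 1$ let $G_m := \mathrm{SL}(2,\mathbb{F}_4) \ltimes \mathrm{M}(2\times m,\mathbb{F}_4)$ be the semidirect product in which $\mathrm{SL}(2,\mathbb{F}_4)$ acts by left multiplication on the additive group $\mathrm{M}(2\times m,\mathbb{F}_4) \cong (\mathbb{F}_4^2)^m$ of $2 \times m$ matrices over $\mathbb{F}_4$. Then $\omega(\mathrm{SL}(2,\mathbb{F}_4)) = 4$, and $\omega(G_m) = 7$ for every $m \ge 2$. In particular, there are infinitely many pairwise non-isomorphic finite non-solvable groups $G$ with $\omega(G) = 7$. -/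

import Mathlib

/-- The number `ω(G)` of automorphism orbits of `G`, i.e. of orbits of the natural action of
`Aut(G)` on `G`, as an element of `ℕ ∪ {∞}`. -/
noncomputable def numAutOrbits (G : Type*) [Group G] : ℕ∞ :=
  ENat.card (MulAction.orbitRel.Quotient (MulAut G) G)

/-- The action of `SL(2,F)` by left multiplication on the additive group of `2 × m` matrices over
`F` (equivalently, the natural componentwise action on the `m` columns, i.e. on `(F²)ᵐ`).
The additive group of matrices is written multiplicatively. -/
def slLeftMul (F : Type*) [Field F] (m : ℕ) :
    Matrix.SpecialLinearGroup (Fin 2) F →*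
      MulAut (Multiplicative (Matrix (Fin 2) (Fin m) F)) where
  toFun X :=
    { toFun := fun Y => Multiplicative.ofAdd (X.1 * Y.toAdd)
      invFun := fun Y => Multiplicative.ofAdd ((X⁻¹).1 * Y.toAdd)
      left_inv := fun Y => by
        have h : (X⁻¹).1 * X.1 = 1 := congrArg Subtype.val (inv_mul_cancel X)
        simp only [toAdd_ofAdd, ← Matrix.mul_assoc, h, Matrix.one_mul, ofAdd_toAdd]
      right_inv := fun Y => by
        have h : X.1 * (X⁻¹).1 = 1 := congrArg Subtype.val (mul_inv_cancel X)
        simp only [toAdd_ofAdd, ← Matrix.mul_assoc, h, Matrix.one_mul, ofAdd_toAdd]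
      map_mul' := fun Y Z => by
        simp only [toAdd_mul, Matrix.mul_add, ofAdd_add] }
  map_one' := by
    ext1 Y
    exact congrArg Multiplicative.ofAdd (Matrix.one_mul Y.toAdd)
  map_mul' X X' := by
    ext1 Y
    exact congrArg Multiplicative.ofAdd (Matrix.mul_assoc X.1 X'.1 Y.toAdd)

/-- The group `SL(2,F) ⋉ M(2 × m, F)`. -/
abbrev SLAffine (F : Type*) [Field F] (m : ℕ) : Type _ :=
  Multiplicative (Matrix (Fin 2) (Fin m) F) ⋊[slLeftMul F m]
    Matrix.SpecialLinearGroup (Fin 2) F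

/-!
Write an element of `SL(2,4) ⋉ M(2 × m, 4)` as a pair `(Y, X)` with linear part `X` and matrix
component `Y`, and write `C t` for the companion matrix of `x² + t x + 1`.

In `SL(2,4)` every nontrivial element is conjugate to `C t` with `t` its trace
(`exists_conj_eq_companionSL`; here it matters that every element of the field is a square). The
field is `{0, 1, w, w²}` with `w² = w + 1`, and the Frobenius fuses `C w` and `C w²`, so the orbits
are represented by `1`, `C 0`, `C 1`, `C w`. They have orders `1`, `2`, `3`, `5`, which separates
them.

In the semidirect product there are, besides inner automorphisms, those given by field
automorphisms and by right multiplication of `Y` with `GL(m,4)`, that is, by linear automorphisms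
of the space of rows. They leave at most seven orbits:
* if `X = 1`, then the rank of `Y` is `0`, `1` or `2`, and `SL(2,4) × GL(m,4)` is transitive on
  matrices of each rank;
* if `X` is conjugate to `C 0`, conjugation by translations reduces `Y` to a single row, which
  `GL(m,4)` moves to `0` or to a fixed nonzero vector;
* otherwise `1 - X` is invertible, and conjugation by translations reduces `Y` to `0`, leaving
  `C 1` and `C w`.

The representatives have orders `1`, `2`, `2`, `2`, `4`, `3`, `5`. The three involutions are
separated by two invariants: whether the element commutes with all its conjugates (true exactly for
those with `X = 1`), and whether its centralizer has exponent dividing two (true in rank two, where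
the centralizer consists of the translations, and false in rank one).

Nonsolvability follows from `SL(2,4)` being perfect, and the groups for different `m` have
different orders.
-/

/-! ### Orbits of the automorphism group -/

/-- `AutRel g h` means that some automorphism of the group maps `g` to `h`. -/
def AutRel {G : Type*} [Group G] (g h : G) : Prop := ∃ φ : MulAut G, φ g = h

namespace AutRel

variable {G : Type*} [Group G] {g h k : G}

theorem refl (g : G) : AutRel g g := ⟨1, rfl⟩

theorem trans : AutRel g h → AutRel h k → AutRel g k := by
  rintro ⟨φ, rfl⟩ ⟨ψ, rfl⟩
  exact ⟨ψ * φ, rfl⟩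

theorem symm : AutRel g h → AutRel h g := by
  rintro ⟨φ, rfl⟩
  exact ⟨φ⁻¹, MulAut.inv_apply_self G φ g⟩

theorem conj (g h : G) : AutRel g (h * g * h⁻¹) := ⟨MulAut.conj h, rfl⟩

theorem orderOf_eq (H : AutRel g h) : orderOf g = orderOf h := by
  obtain ⟨φ, rfl⟩ := H
  exact (MulEquiv.orderOf_eq φ g).symm

theorem forall_commute_sq_eq_one (H : AutRel g h) (hg : ∀ x, Commute x g → x ^ 2 = 1) (x : G)
    (hx : Commute x h) : x ^ 2 = 1 := by
  obtain ⟨φ, rfl⟩ := H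
  have h1 : Commute (φ.symm x) g := by simpa using hx.map φ.symm
  simpa using congrArg φ (hg _ h1)

theorem forall_commute_conj (H : AutRel g h) (hg : ∀ x, Commute (x * g * x⁻¹) g) (x : G) :
    Commute (x * h * x⁻¹) h := by
  obtain ⟨φ, rfl⟩ := H
  simpa using (hg (φ.symm x)).map φ

end AutRel

/-- A complete and irredundant family of representatives counts the automorphism orbits. -/
theorem numAutOrbits_eq_of_representatives {G : Type*} [Group G] {n : ℕ} (r : Fin n → G)
    (hcov : ∀ g, ∃ i, AutRel g (r i)) (hsep : ∀ i j, AutRel (r i) (r j) → i = j) :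
    numAutOrbits G = n := by
  have hbij : Function.Bijective
      (fun i => (Quotient.mk'' (r i) : MulAction.orbitRel.Quotient (MulAut G) G)) := by
    constructor
    · intro i j h
      obtain ⟨φ, hφ⟩ := MulAction.orbitRel_apply.mp (Quotient.exact h)
      exact (hsep j i ⟨φ, hφ⟩).symm
    · intro q
      induction q using Quotient.inductionOn' with
      | h g =>
        obtain ⟨i, φ, hφ⟩ := hcov g
        exact ⟨i, Quotient.sound (MulAction.orbitRel_apply.mpr ⟨φ, hφ⟩)⟩
  rw [numAutOrbits, ← ENat.card_congr (Equiv.ofBijective _ hbij)]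
  simp

/-! ### Finite fields with four elements -/

section FieldFour

variable {F : Type*} [Field F]

theorem pow_four_of_card_eq_four [Finite F] (hF : Nat.card F = 4) (x : F) : x ^ 4 = x := by
  have := Fintype.ofFinite F
  have h := FiniteField.pow_card x
  rwa [← Nat.card_eq_fintype_card, hF] at h

theorem exists_sq_eq_add_one [CharP F 2] [Finite F] (hF : Nat.card F = 4) :
    ∃ w : F, w ^ 2 = w + 1 := by
  have := Fintype.ofFinite F
  classical
  obtain ⟨w, hw⟩ : ∃ w : F, w ∉ ({0, 1} : Finset F) := by
    by_contra! h
    have h1 : Finset.univ ⊆ ({0, 1} : Finset F) := fun x _ => h x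
    have h2 := (Finset.card_le_card h1).trans Finset.card_le_two
    rw [Finset.card_univ, ← Nat.card_eq_fintype_card, hF] at h2
    omega
  have h4 := pow_four_of_card_eq_four hF w
  have h2 : (2 : F) = 0 := CharTwo.two_eq_zero
  simp only [Finset.mem_insert, Finset.mem_singleton, not_or] at hw
  refine ⟨w, mul_left_cancel₀ (mul_ne_zero hw.1 (sub_ne_zero.mpr hw.2)) ?_⟩
  linear_combination h4 - (w ^ 3 - w) * h2

theorem eq_zero_or_one_or_primitive [CharP F 2] {w : F} (hw : w ^ 2 = w + 1) {x : F}
    (hx : x ^ 4 = x) : x = 0 ∨ x = 1 ∨ x = w ∨ x = w ^ 2 := by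
  have h2 : (2 : F) = 0 := CharTwo.two_eq_zero
  have h : x * ((x - 1) * ((x - w) * (x - w ^ 2))) = 0 := by grind
  simpa only [mul_eq_zero, sub_eq_zero] using h

theorem primitive_ne_zero {w : F} (hw : w ^ 2 = w + 1) : w ≠ 0 := by
  rintro rfl
  simp at hw

end FieldFour

/-! ### Conjugacy and automorphism orbits in `SL(2,4)` -/

section SL

open Matrix

variable {F : Type*} [Field F] [CharP F 2]

/-- The companion matrix of `x² - t x + 1` in characteristic two, where `-1 = 1`. -/
def companionSL (t : F) : SpecialLinearGroup (Fin 2) F :=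
  ⟨!![0, 1; 1, t], by simp [det_fin_two, CharTwo.neg_eq]⟩

@[simp]
theorem coe_companionSL (t : F) :
    (companionSL t : Matrix (Fin 2) (Fin 2) F) = !![0, 1; 1, t] := rfl

/-- A nontrivial element `X` of `SL(2,F)` in characteristic two is not a scalar, so some row vector
`p = (x, y)` is linearly independent of `pX`; the displayed expression is `det (p; pX)`. -/
theorem exists_row_mul_det_ne_zero {X : SpecialLinearGroup (Fin 2) F} (hX : X ≠ 1) :
    ∃ x y : F, x * (x * X.1 0 1 + y * X.1 1 1) - y * (x * X.1 0 0 + y * X.1 1 0) ≠ 0 := by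
  have hdet : X.1 0 0 * X.1 1 1 - X.1 0 1 * X.1 1 0 = 1 := by
    rw [← det_fin_two]; exact X.2
  by_contra! h
  have hb := h 1 0
  have hc := h 0 1
  have hd := h 1 1
  have h2 : (2 : F) = 0 := CharTwo.two_eq_zero
  simp only [one_mul, zero_mul, add_zero, zero_add, sub_zero, zero_sub, neg_eq_zero] at hb hc hd
  have ha : X.1 0 0 = 1 := by
    have : (X.1 0 0 - 1) ^ 2 = 0 := by grind
    simpa [sub_eq_zero] using this
  apply hX
  ext i j
  fin_cases i <;> fin_cases j <;> simp <;> grind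

/-- A nontrivial element of `SL(2,4)` is determined up to conjugacy by its trace: a cyclic row
vector `p` with `det (p; pX) = 1` gives the conjugating matrix. It exists because scaling `p` by
`s` scales that determinant by `s²`, and every element of the field is a square. -/
theorem exists_conj_eq_companionSL (h4 : ∀ x : F, x ^ 4 = x)
    {X : SpecialLinearGroup (Fin 2) F} (hX : X ≠ 1) :
    ∃ (P : SpecialLinearGroup (Fin 2) F) (t : F), P * X * P⁻¹ = companionSL t := by
  obtain ⟨x, y, hv⟩ := exists_row_mul_det_ne_zero hX
  have hdet : X.1 0 0 * X.1 1 1 - X.1 0 1 * X.1 1 0 = 1 := by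
    rw [← det_fin_two]; exact X.2
  set a := X.1 0 0
  set b := X.1 0 1
  set c := X.1 1 0
  set d := X.1 1 1
  set v := x * (x * b + y * d) - y * (x * a + y * c) with hv_def
  have hv3 : v ^ 3 = 1 := mul_left_cancel₀ hv (by linear_combination h4 v)
  have hXm : X.1 = !![a, b; c, d] := eta_fin_two X.1
  have h2 : (2 : F) = 0 := CharTwo.two_eq_zero
  have hP : det !![v * x, v * y; v * (x * a + y * c), v * (x * b + y * d)] = 1 := by
    rw [det_fin_two_of]
    linear_combination hv3 + v ^ 2 * hv_def
  refine ⟨⟨_, hP⟩, a + d, mul_inv_eq_iff_eq_mul.mpr (Subtype.ext ?_)⟩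
  change _ * X.1 = !![0, 1; 1, a + d] * _
  rw [hXm]
  ext i j
  fin_cases i <;> fin_cases j <;> simp [mul_apply, Fin.sum_univ_two] <;> grind

theorem companionSL_ne_one (t : F) : companionSL t ≠ 1 := by
  intro h
  simpa using congrArg (fun X : SpecialLinearGroup (Fin 2) F => X.1 0 0) h

theorem orderOf_companionSL_zero : orderOf (companionSL (0 : F)) = 2 := by
  refine orderOf_eq_prime (Subtype.ext ?_) (companionSL_ne_one 0)
  ext i j
  fin_cases i <;> fin_cases j <;> simp [pow_two]

theorem orderOf_companionSL_one : orderOf (companionSL (1 : F)) = 3 := by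
  refine orderOf_eq_prime (Subtype.ext ?_) (companionSL_ne_one 1)
  ext i j
  fin_cases i <;> fin_cases j <;> simp [pow_succ] <;> grind

theorem orderOf_companionSL_primitive {w : F} (hw : w ^ 2 = w + 1) :
    orderOf (companionSL w) = 5 := by
  have : Fact (Nat.Prime 5) := ⟨by norm_num⟩
  refine orderOf_eq_prime (Subtype.ext ?_) (companionSL_ne_one w)
  ext i j
  fin_cases i <;> fin_cases j <;> simp [pow_succ] <;> grind

/-- The automorphism of `SL(2,F)` induced by a field automorphism. -/
def slMapEquiv (σ : F ≃+* F) : MulAut (SpecialLinearGroup (Fin 2) F) where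
  toFun := SpecialLinearGroup.map σ.toRingHom
  invFun := SpecialLinearGroup.map σ.symm.toRingHom
  left_inv X := by ext; simp
  right_inv X := by ext; simp
  map_mul' := map_mul _

theorem slMapEquiv_companionSL (σ : F ≃+* F) (t : F) :
    slMapEquiv σ (companionSL t) = companionSL (σ t) := by
  ext i j
  fin_cases i <;> fin_cases j <;> simp [slMapEquiv]

/-- The Frobenius exchanges the two traces `w` and `w²` of elements of order five, and so fuses
the two classes of such elements. -/
theorem autRel_companionSL_primitive_sq [Finite F] (h4 : ∀ x : F, x ^ 4 = x) (w : F) :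
    AutRel (companionSL (w ^ 2)) (companionSL w) := by
  refine ⟨slMapEquiv (frobeniusEquiv F 2), ?_⟩
  rw [slMapEquiv_companionSL, frobeniusEquiv_def, ← pow_mul, h4]

theorem numAutOrbits_SL [Finite F] (hF : Nat.card F = 4) :
    numAutOrbits (SpecialLinearGroup (Fin 2) F) = 4 := by
  have h4 := pow_four_of_card_eq_four hF
  obtain ⟨w, hw⟩ := exists_sq_eq_add_one hF
  have horder : ∀ i, orderOf (![1, companionSL 0, companionSL 1, companionSL w] i) =
      ![1, 2, 3, 5] i := by
    intro i
    fin_cases i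
    · exact orderOf_one
    · exact orderOf_companionSL_zero
    · exact orderOf_companionSL_one
    · exact orderOf_companionSL_primitive hw
  refine numAutOrbits_eq_of_representatives
    ![1, companionSL 0, companionSL 1, companionSL w] (fun X => ?_) (fun i j h => ?_)
  · rcases eq_or_ne X 1 with rfl | hX
    · exact ⟨0, AutRel.refl 1⟩
    obtain ⟨P, t, hP⟩ := exists_conj_eq_companionSL h4 hX
    have hXt : AutRel X (companionSL t) := hP ▸ AutRel.conj X P
    rcases eq_zero_or_one_or_primitive hw (h4 t) with rfl | rfl | rfl | rfl
    · exact ⟨1, hXt⟩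
    · exact ⟨2, hXt⟩
    · exact ⟨3, hXt⟩
    · exact ⟨3, hXt.trans (autRel_companionSL_primitive_sq h4 w)⟩
  · have := h.orderOf_eq
    rw [horder, horder] at this
    exact (by decide : Function.Injective ![1, 2, 3, 5]) this

/-- `SL(2,F)` is perfect as soon as `F` has an element `w ≠ 0` with `w² ≠ 1`. -/
theorem not_isSolvable_SL {w : F} (hw : w ^ 2 = w + 1) :
    ¬ Group.IsSolvable (SpecialLinearGroup (Fin 2) F) := by
  intro _
  have : Nontrivial (SpecialLinearGroup (Fin 2) F) := ⟨_, _, companionSL_ne_one 0⟩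
  refine (Group.IsSolvable.commutator_lt_top_of_nontrivial
    (SpecialLinearGroup (Fin 2) F)).ne (SL2.commutator_eq_top (primitive_ne_zero hw) fun h => ?_)
  rw [hw] at h
  exact primitive_ne_zero hw (by simpa using h)

end SL

/-! ### Automorphisms and automorphism orbits of `SL(2,4) ⋉ M(2 × m, 4)` -/

/-- The general linear group is transitive on linearly independent families of a given finite
length. -/
theorem LinearIndependent.exists_linearEquiv_apply_eq {K V ι : Type*} [Field K] [AddCommGroup V]
    [Module K V] [Finite ι] {v w : ι → V} (hv : LinearIndependent K v)
    (hw : LinearIndependent K w) : ∃ e : V ≃ₗ[K] V, ∀ i, e (v i) = w i := by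
  have : FiniteDimensional K (Submodule.span K (Set.range v)) :=
    FiniteDimensional.span_of_finite K (Set.finite_range v)
  obtain ⟨e, he⟩ := Submodule.exists_linearEquiv_restrict_eq
    (hv.linearCombinationEquiv.symm ≪≫ₗ hw.linearCombinationEquiv)
  refine ⟨e, fun i => ?_⟩
  have h := he (hv.linearCombinationEquiv (Finsupp.single i 1))
  simpa using h.symm

namespace SLAffine

open Matrix

variable {F : Type*} {m : ℕ}

/-- The matrix with rows `a` and `b`. -/
def rows (a b : Fin m → F) : Matrix (Fin 2) (Fin m) F := Matrix.of ![a, b]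

@[simp]
theorem rows_apply_zero (a b : Fin m → F) : rows a b 0 = a := rfl

@[simp]
theorem rows_apply_one (a b : Fin m → F) : rows a b 1 = b := rfl

theorem eq_rows (Y : Matrix (Fin 2) (Fin m) F) : Y = rows (Y 0) (Y 1) := by
  ext i j; fin_cases i <;> rfl

theorem rows_inj {a b c d : Fin m → F} : rows a b = rows c d ↔ a = c ∧ b = d := by
  simp [rows]

variable [Field F]

/-- The element of `SL(2,F) ⋉ M(2 × m, F)` with matrix component `Y` and linear part `X`. -/
def mk (Y : Matrix (Fin 2) (Fin m) F) (X : SpecialLinearGroup (Fin 2) F) : SLAffine F m :=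
  ⟨Multiplicative.ofAdd Y, X⟩

theorem exists_eq_mk (g : SLAffine F m) : ∃ Y X, g = mk Y X := ⟨g.left.toAdd, g.right, rfl⟩

theorem one_eq_mk : (1 : SLAffine F m) = mk 0 1 := rfl

theorem mk_mul_mk (Y Y' : Matrix (Fin 2) (Fin m) F) (X X' : SpecialLinearGroup (Fin 2) F) :
    mk Y X * mk Y' X' = mk (Y + (X : Matrix (Fin 2) (Fin 2) F) * Y') (X * X') := rfl

theorem mk_inj {Y Y' : Matrix (Fin 2) (Fin m) F} {X X' : SpecialLinearGroup (Fin 2) F} :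
    mk Y X = mk Y' X' ↔ Y = Y' ∧ X = X' := by
  simp only [mk, SemidirectProduct.ext_iff, EmbeddingLike.apply_eq_iff_eq]

theorem inr_eq_mk (X : SpecialLinearGroup (Fin 2) F) :
    (SemidirectProduct.inr X : SLAffine F m) = mk 0 X := rfl

theorem mul_rows (X : Matrix (Fin 2) (Fin 2) F) (a b : Fin m → F) :
    X * rows a b = rows (X 0 0 • a + X 0 1 • b) (X 1 0 • a + X 1 1 • b) := by
  ext i j
  fin_cases i <;> simp [rows, mul_apply, Fin.sum_univ_two]

theorem rows_add_rows (a b c d : Fin m → F) : rows a b + rows c d = rows (a + c) (b + d) := by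
  ext i j; fin_cases i <;> rfl

theorem rows_zero : (rows 0 0 : Matrix (Fin 2) (Fin m) F) = 0 := by
  ext i j; fin_cases i <;> rfl

/-- Conjugation by the linear part. -/
theorem autRel_conj_linear (P : SpecialLinearGroup (Fin 2) F) (Y : Matrix (Fin 2) (Fin m) F)
    (X : SpecialLinearGroup (Fin 2) F) :
    AutRel (mk Y X) (mk ((P : Matrix (Fin 2) (Fin 2) F) * Y) (P * X * P⁻¹)) := by
  have h := AutRel.conj (mk Y X) (mk 0 P)
  rwa [(_ : mk 0 P * mk Y X * (mk 0 P)⁻¹ =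
    mk ((P : Matrix (Fin 2) (Fin 2) F) * Y) (P * X * P⁻¹))] at h
  rw [mul_inv_eq_iff_eq_mul, mk_mul_mk, mk_mul_mk]
  simp

/-- Conjugation by translations. -/
theorem autRel_conj_translation (Z Y : Matrix (Fin 2) (Fin m) F)
    (X : SpecialLinearGroup (Fin 2) F) :
    AutRel (mk Y X) (mk (Z + Y - (X : Matrix (Fin 2) (Fin 2) F) * Z) X) := by
  have h := AutRel.conj (mk Y X) (mk Z 1)
  rwa [(_ : mk Z 1 * mk Y X * (mk Z 1)⁻¹ =
    mk (Z + Y - (X : Matrix (Fin 2) (Fin 2) F) * Z) X)] at h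
  rw [mul_inv_eq_iff_eq_mul, mk_mul_mk, mk_mul_mk]
  simp

/-- The automorphism induced by a linear automorphism of the space of rows, that is, by right
multiplication with an invertible `m × m` matrix. -/
theorem autRel_rows (e : (Fin m → F) ≃ₗ[F] (Fin m → F)) (a b : Fin m → F)
    (X : SpecialLinearGroup (Fin 2) F) :
    AutRel (mk (rows a b) X) (mk (rows (e a) (e b)) X) := by
  let E : Matrix (Fin 2) (Fin m) F ≃+ Matrix (Fin 2) (Fin m) F :=
    { toFun := fun Y => rows (e (Y 0)) (e (Y 1))
      invFun := fun Y => rows (e.symm (Y 0)) (e.symm (Y 1))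
      left_inv := fun Y => by
        conv_rhs => rw [eq_rows Y]
        simp
      right_inv := fun Y => by
        conv_rhs => rw [eq_rows Y]
        simp
      map_add' := fun Y Z => by
        rw [rows_add_rows, ← map_add, ← map_add]; rfl }
  refine ⟨SemidirectProduct.congr E.toMultiplicative (MulEquiv.refl _) fun X => ?_, rfl⟩
  ext1 Y
  change Multiplicative.ofAdd (E ((X : Matrix (Fin 2) (Fin 2) F) * Y.toAdd)) =
    Multiplicative.ofAdd ((X : Matrix (Fin 2) (Fin 2) F) * E Y.toAdd)
  congr 1
  rw [eq_rows Y.toAdd, mul_rows]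
  change rows (e _) (e _) = (X : Matrix (Fin 2) (Fin 2) F) * rows (e _) (e _)
  rw [mul_rows]
  simp

/-- Field automorphisms act on both factors simultaneously. -/
theorem autRel_zero_map [CharP F 2] (σ : F ≃+* F) (X : SpecialLinearGroup (Fin 2) F) :
    AutRel (mk (0 : Matrix (Fin 2) (Fin m) F) X) (mk 0 (slMapEquiv σ X)) := by
  refine ⟨SemidirectProduct.congr (σ.toAddEquiv.mapMatrix).toMultiplicative
    (slMapEquiv σ) fun X => ?_, ?_⟩
  · ext1 Y
    change Multiplicative.ofAdd (((X : Matrix (Fin 2) (Fin 2) F) * Y.toAdd).map σ) =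
      Multiplicative.ofAdd ((X : Matrix (Fin 2) (Fin 2) F).map σ * Y.toAdd.map σ)
    rw [Matrix.map_mul]
  · change mk ((0 : Matrix (Fin 2) (Fin m) F).map σ) (slMapEquiv σ X) = _
    simp

/-! ### Representatives of the seven orbits -/

/-- Up to automorphism, a matrix component with zero second row has first row `0` or `a`, where
`a` is any fixed nonzero row. -/
theorem autRel_rows_zero {a : Fin m → F} (ha : a ≠ 0) (r : Fin m → F)
    (X : SpecialLinearGroup (Fin 2) F) :
    AutRel (mk (rows r 0) X) (mk 0 X) ∨ AutRel (mk (rows r 0) X) (mk (rows a 0) X) := by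
  rcases eq_or_ne r 0 with rfl | hr
  · rw [rows_zero]
    exact Or.inl (AutRel.refl _)
  · obtain ⟨e, he⟩ := LinearIndependent.exists_linearEquiv_apply_eq (K := F)
      (v := fun _ : Unit => r) (w := fun _ => a) (.of_subsingleton () hr) (.of_subsingleton () ha)
    have := autRel_rows e r 0 X
    rw [he (), map_zero] at this
    exact Or.inr this

theorem commute_mk_mk_one_iff {Z Y : Matrix (Fin 2) (Fin m) F}
    {X : SpecialLinearGroup (Fin 2) F} :
    Commute (mk Z X) (mk Y 1) ↔ (X : Matrix (Fin 2) (Fin 2) F) * Y = Y := by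
  rw [commute_iff_eq, mk_mul_mk, mk_mul_mk, mk_inj]
  simp [add_comm Y Z]

theorem mk_sq (Y : Matrix (Fin 2) (Fin m) F) (X : SpecialLinearGroup (Fin 2) F) :
    mk Y X ^ 2 = mk (Y + (X : Matrix (Fin 2) (Fin 2) F) * Y) (X ^ 2) := by
  rw [pow_two, mk_mul_mk, pow_two]

theorem orderOf_mk_zero (X : SpecialLinearGroup (Fin 2) F) :
    orderOf (mk (0 : Matrix (Fin 2) (Fin m) F) X) = orderOf X := by
  rw [← inr_eq_mk]
  exact orderOf_injective _ SemidirectProduct.inr_injective X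

/-- If the rows of a matrix are dependent, an element of `SL(2,F)` clears its second row. -/
theorem exists_autRel_rows_zero {r s : Fin m → F} (h : ¬ LinearIndependent F ![r, s]) :
    ∃ u, AutRel (mk (rows r s) 1) (mk (rows u 0) 1) := by
  simp only [LinearIndependent.pair_iff, not_forall] at h
  obtain ⟨x, y, hxy, h0⟩ := h
  obtain ⟨p, q, hpq⟩ : ∃ p q : F, p * y - q * x = 1 := by
    by_cases hx : x = 0
    · have hy : y ≠ 0 := fun hy => h0 ⟨hx, hy⟩
      exact ⟨y⁻¹, 0, by simp [hy]⟩
    · exact ⟨0, -x⁻¹, by simp [hx]⟩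
  obtain ⟨P, hP⟩ : ∃ P : SpecialLinearGroup (Fin 2) F,
      (P : Matrix (Fin 2) (Fin 2) F) = !![p, q; x, y] := ⟨⟨_, by rw [det_fin_two_of, hpq]⟩, rfl⟩
  have := autRel_conj_linear P (rows r s) 1
  rw [mul_one, mul_inv_cancel, hP, mul_rows] at this
  simp only [of_apply, cons_val', cons_val_zero, cons_val_one, cons_val_fin_one, hxy] at this
  exact ⟨_, this⟩

/-- Translations form an abelian normal subgroup, so they commute with their conjugates. -/
theorem forall_commute_conj_mk_one (Y : Matrix (Fin 2) (Fin m) F) (x : SLAffine F m) :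
    Commute (x * mk Y 1 * x⁻¹) (mk Y 1) := by
  obtain ⟨Z, X, hZ⟩ := exists_eq_mk (x * mk Y 1 * x⁻¹)
  have hX : X = 1 := (congrArg SemidirectProduct.right hZ).symm.trans (by simp [mk])
  subst hX
  rw [hZ]
  exact commute_mk_mk_one_iff.mpr (by simp)

/-- The elementary transvection with upper right entry `1`. -/
def transvectionSL (F : Type*) [Field F] : SpecialLinearGroup (Fin 2) F :=
  ⟨!![1, 1; 0, 1], by simp⟩

@[simp]
theorem coe_transvectionSL :
    (transvectionSL F : Matrix (Fin 2) (Fin 2) F) = !![1, 1; 0, 1] := rfl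

/-- A translation by a matrix of rank one commutes with an element that does not square to `1` and
whose linear part is a transvection fixing the columns of that matrix. -/
theorem not_forall_commute_mk_rows_zero_sq_eq_one {a : Fin m → F} (ha : a ≠ 0) :
    ¬ ∀ x : SLAffine F m, Commute x (mk (rows a 0) 1) → x ^ 2 = 1 := by
  intro h
  have h1 := h (mk (rows 0 a) (transvectionSL F)) (by
    rw [commute_mk_mk_one_iff, mul_rows, rows_inj]
    simp)
  rw [mk_sq, one_eq_mk, mk_inj, mul_rows, rows_add_rows, ← rows_zero, rows_inj] at h1
  exact ha (by simpa using h1.1.1)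

section Representatives

variable [CharP F 2]

theorem add_self_matrix (Y : Matrix (Fin 2) (Fin m) F) : Y + Y = 0 := by
  ext i j
  exact CharTwo.add_self_eq_zero _

/-- When the linear part is the involution swapping the rows, translations change the matrix
component by matrices with two equal rows, so that only the sum of the rows matters. -/
theorem autRel_mk_companionSL_zero (r s : Fin m → F) :
    AutRel (mk (rows r s) (companionSL 0)) (mk (rows (r + s) 0) (companionSL 0)) := by
  have h := autRel_conj_translation (rows s 0) (rows r s) (companionSL 0)
  rwa [(_ : rows s 0 + rows r s - (companionSL (0 : F) : Matrix (Fin 2) (Fin 2) F) * rows s 0 =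
    rows (r + s) 0)] at h
  rw [sub_eq_iff_eq_add, mul_rows, rows_add_rows, rows_add_rows, rows_inj]
  simp [add_comm]

/-- If `t ≠ 0`, then `1` is not an eigenvalue of the linear part, and a suitable translation
conjugates the element into `SL(2,F)`. -/
theorem autRel_mk_companionSL {t : F} (ht : t ≠ 0) (Y : Matrix (Fin 2) (Fin m) F) :
    AutRel (mk Y (companionSL t)) (mk 0 (companionSL t)) := by
  have h2 : (2 : F) = 0 := CharTwo.two_eq_zero
  obtain ⟨r, s, rfl⟩ : ∃ r s, Y = rows r s := ⟨_, _, eq_rows Y⟩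
  -- the unique solution `(z, z')` of `z + r = z'`, `z' + s = z + t z'`
  have h := autRel_conj_translation (rows (t⁻¹ • (r + s) - r) (t⁻¹ • (r + s))) (rows r s)
    (companionSL t)
  rwa [sub_eq_zero.mpr] at h
  rw [mul_rows, rows_add_rows, rows_inj]
  constructor
  · simp
  · simp [smul_smul, ht]
    abel

theorem orderOf_mk_one {Y : Matrix (Fin 2) (Fin m) F} (hY : Y ≠ 0) : orderOf (mk Y 1) = 2 := by
  refine orderOf_eq_prime ?_ ?_
  · simp [mk_sq, add_self_matrix, one_eq_mk]
  · simpa [one_eq_mk, mk_inj] using hY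

theorem companionSL_zero_sq : companionSL (0 : F) ^ 2 = 1 :=
  orderOf_dvd_iff_pow_eq_one.mp orderOf_companionSL_zero.dvd

theorem orderOf_mk_rows_companionSL_zero {a : Fin m → F} (ha : a ≠ 0) :
    orderOf (mk (rows a 0) (companionSL 0)) = 4 := by
  have hsq : mk (rows a 0) (companionSL 0) ^ 2 = mk (rows a a) 1 := by
    rw [mk_sq, companionSL_zero_sq, mul_rows, rows_add_rows]
    simp
  refine orderOf_eq_prime_pow (p := 2) (n := 1) ?_ ?_
  · rw [pow_one, hsq, one_eq_mk, mk_inj, ← rows_zero, rows_inj]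
    exact fun h => ha h.1.1
  · rw [pow_succ, pow_one, pow_mul, hsq, mk_sq]
    simp [add_self_matrix, one_eq_mk]

/-- An involution outside the translation subgroup fails to commute with some conjugate. -/
theorem not_forall_commute_conj_companionSL_zero :
    ¬ ∀ x : SLAffine F m, Commute (x * mk 0 (companionSL 0) * x⁻¹) (mk 0 (companionSL 0)) := by
  intro h
  have h1 := (h (mk 0 (transvectionSL F))).map
    (SemidirectProduct.rightHom : SLAffine F m →* SpecialLinearGroup (Fin 2) F)
  change Commute (transvectionSL F * companionSL 0 * (transvectionSL F)⁻¹) (companionSL 0) at h1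
  have h2 := congrArg (fun X : SpecialLinearGroup (Fin 2) F => X.1 0 0) h1.eq
  simp [adjugate_fin_two] at h2

/-- A translation by a matrix of rank two is centralized only by translations, which square to
`1`. -/
theorem forall_commute_mk_rows_sq_eq_one {a b : Fin m → F} (hab : LinearIndependent F ![a, b])
    (x : SLAffine F m) (hx : Commute x (mk (rows a b) 1)) : x ^ 2 = 1 := by
  obtain ⟨Z, X, rfl⟩ := exists_eq_mk x
  have h := commute_mk_mk_one_iff.mp hx
  rw [mul_rows, rows_inj] at h
  rw [LinearIndependent.pair_iff] at hab
  have h1 := hab (X.1 0 0 - 1) (X.1 0 1) (by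
    rw [sub_smul, one_smul, sub_add_eq_add_sub, h.1, sub_self])
  have h2 := hab (X.1 1 0) (X.1 1 1 - 1) (by
    rw [sub_smul, one_smul, ← add_sub_assoc, h.2, sub_self])
  have hX : X = 1 := by
    ext i j
    fin_cases i <;> fin_cases j <;> simp [h1.2, h2.1, sub_eq_zero.mp h1.1, sub_eq_zero.mp h2.2]
  subst hX
  simp [mk_sq, add_self_matrix, one_eq_mk]

end Representatives

theorem numAutOrbits_eq_seven [CharP F 2] [Finite F] (hF : Nat.card F = 4) (hm : 2 ≤ m) :
    numAutOrbits (SLAffine F m) = 7 := by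
  have h4 := pow_four_of_card_eq_four hF
  obtain ⟨w, hw⟩ := exists_sq_eq_add_one hF
  obtain ⟨a, b, hab⟩ : ∃ a b : Fin m → F, LinearIndependent F ![a, b] := by
    have h := (Pi.basisFun F (Fin m)).linearIndependent.comp _ (Fin.castLE_injective hm)
    set v := Pi.basisFun F (Fin m) ∘ Fin.castLE hm
    refine ⟨v 0, v 1, ?_⟩
    rwa [(_ : ![v 0, v 1] = v)]
    ext i : 1
    fin_cases i <;> rfl
  have ha : a ≠ 0 := hab.ne_zero 0
  let r : Fin 7 → SLAffine F m := ![1, mk (rows a 0) 1, mk (rows a b) 1, mk 0 (companionSL 0),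
    mk (rows a 0) (companionSL 0), mk 0 (companionSL 1), mk 0 (companionSL w)]
  have horder : ∀ i, orderOf (r i) = ![1, 2, 2, 2, 4, 3, 5] i := by
    intro i
    fin_cases i
    · exact orderOf_one
    · refine orderOf_mk_one fun h => ha ?_
      rw [← rows_zero, rows_inj] at h
      exact h.1
    · refine orderOf_mk_one fun h => ha ?_
      rw [← rows_zero, rows_inj] at h
      exact h.1
    · exact (orderOf_mk_zero _).trans orderOf_companionSL_zero
    · exact orderOf_mk_rows_companionSL_zero ha
    · exact (orderOf_mk_zero _).trans orderOf_companionSL_one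
    · exact (orderOf_mk_zero _).trans (orderOf_companionSL_primitive hw)
  refine numAutOrbits_eq_of_representatives r (fun g => ?_) (fun i j h => ?_)
  · obtain ⟨Y, X, rfl⟩ := exists_eq_mk g
    rcases eq_or_ne X 1 with rfl | hX
    · rw [eq_rows Y]
      by_cases hY : LinearIndependent F ![Y 0, Y 1]
      · obtain ⟨e, he⟩ := hY.exists_linearEquiv_apply_eq hab
        have h := autRel_rows e (Y 0) (Y 1) 1
        rw [show e (Y 0) = a from he 0, show e (Y 1) = b from he 1] at h
        exact ⟨2, h⟩
      · obtain ⟨u, hu⟩ := exists_autRel_rows_zero hY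
        rcases autRel_rows_zero ha u 1 with h | h
        · exact ⟨0, hu.trans h⟩
        · exact ⟨1, hu.trans h⟩
    · obtain ⟨P, t, hP⟩ := exists_conj_eq_companionSL h4 hX
      have hYX := autRel_conj_linear P Y X
      rw [hP] at hYX
      rcases eq_zero_or_one_or_primitive hw (h4 t) with rfl | rfl | rfl | rfl
      · rw [eq_rows ((P : Matrix (Fin 2) (Fin 2) F) * Y)] at hYX
        have h0 := hYX.trans (autRel_mk_companionSL_zero _ _)
        rcases autRel_rows_zero ha _ (companionSL 0) with h | h
        · exact ⟨3, h0.trans h⟩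
        · exact ⟨4, h0.trans h⟩
      · exact ⟨5, hYX.trans (autRel_mk_companionSL one_ne_zero _)⟩
      · exact ⟨6, hYX.trans (autRel_mk_companionSL (primitive_ne_zero hw) _)⟩
      · have h0 := hYX.trans (autRel_mk_companionSL (pow_ne_zero 2 (primitive_ne_zero hw)) _)
        have h1 := autRel_zero_map (m := m) (frobeniusEquiv F 2) (companionSL (w ^ 2))
        rw [slMapEquiv_companionSL, frobeniusEquiv_def, ← pow_mul, h4] at h1
        exact ⟨6, h0.trans h1⟩
  · have h12 : ¬ AutRel (mk (rows a 0) 1) (mk (rows a b) 1) := fun h =>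
      not_forall_commute_mk_rows_zero_sq_eq_one ha
        (h.symm.forall_commute_sq_eq_one (forall_commute_mk_rows_sq_eq_one hab))
    have h3 : ∀ Y, ¬ AutRel (mk Y 1) (mk (0 : Matrix (Fin 2) (Fin m) F) (companionSL 0)) :=
      fun Y h => not_forall_commute_conj_companionSL_zero
        (h.forall_commute_conj (forall_commute_conj_mk_one Y))
    -- element orders separate all representatives except the three involutions
    have key : ∀ i j : Fin 7, (![1, 2, 2, 2, 4, 3, 5] i : ℕ) = ![1, 2, 2, 2, 4, 3, 5] j → i < j →
        (i = 1 ∧ j = 2) ∨ (i = 1 ∧ j = 3) ∨ (i = 2 ∧ j = 3) := by decide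
    have hlt : ∀ i j, AutRel (r i) (r j) → ¬ i < j := by
      intro i j h hij
      have ho := h.orderOf_eq
      rw [horder, horder] at ho
      rcases key i j ho hij with ⟨rfl, rfl⟩ | ⟨rfl, rfl⟩ | ⟨rfl, rfl⟩
      · exact h12 h
      · exact h3 _ h
      · exact h3 _ h
    exact le_antisymm (not_lt.mp (hlt j i h.symm)) (not_lt.mp (hlt i j h))

theorem not_isSolvable [CharP F 2] {w : F} (hw : w ^ 2 = w + 1) :
    ¬ Group.IsSolvable (SLAffine F m) := fun _ =>
  not_isSolvable_SL hw (Group.isSolvable_of_surjective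
    (SemidirectProduct.rightHom_surjective (φ := slLeftMul F m)))

theorem finite [Finite F] : Finite (SLAffine F m) :=
  have : Finite (Multiplicative (Matrix (Fin 2) (Fin m) F)) := inferInstanceAs
    (Finite (Fin 2 → Fin m → F))
  Finite.of_equiv _ SemidirectProduct.equivProd.symm

/-- The order of `SL(2,F) ⋉ M(2 × m, F)` determines `m`. -/
theorem eq_of_mulEquiv [Finite F] {m n : ℕ} (e : SLAffine F m ≃* SLAffine F n) : m = n := by
  have h := Nat.card_congr e.toEquiv
  have hcard (k : ℕ) :
      Nat.card (Multiplicative (Matrix (Fin 2) (Fin k) F)) = (Nat.card F ^ k) ^ 2 := by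
    rw [Nat.card_congr Multiplicative.toAdd]
    change Nat.card (Fin 2 → Fin k → F) = _
    simp [Nat.card_fun]
  rw [SemidirectProduct.card, SemidirectProduct.card, hcard, hcard] at h
  have h1 := Nat.pow_left_injective two_ne_zero (Nat.eq_of_mul_eq_mul_right Nat.card_pos h)
  exact Nat.pow_right_injective Finite.one_lt_card h1

end SLAffine

theorem mainTheorem4 :
    numAutOrbits (Matrix.SpecialLinearGroup (Fin 2) (GaloisField 2 2)) = 4 ∧
    (∀ m : ℕ, 2 ≤ m → numAutOrbits (SLAffine (GaloisField 2 2) m) = 7) ∧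
    (∃ G : ℕ → GrpCat.{0},
      (∀ i, Finite (G i) ∧ ¬ Group.IsSolvable (G i) ∧ numAutOrbits (G i) = 7) ∧
      Pairwise fun i j => IsEmpty (G i ≃* G j)) := by
  have hF : Nat.card (GaloisField 2 2) = 4 := GaloisField.card 2 2 two_ne_zero
  obtain ⟨w, hw⟩ := exists_sq_eq_add_one hF
  refine ⟨numAutOrbits_SL hF, fun m hm => SLAffine.numAutOrbits_eq_seven hF hm,
    fun i => GrpCat.of (SLAffine (GaloisField 2 2) (i + 2)),
    fun i => ⟨SLAffine.finite, SLAffine.not_isSolvable hw,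
      SLAffine.numAutOrbits_eq_seven hF (by omega)⟩,
    fun i j hij => ⟨fun e => hij ?_⟩⟩
  have := SLAffine.eq_of_mulEquiv e
  omega
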